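/- Let $\phi:\mathbb{R}\to[0,\infty)$ be convex with $\phi(0)=0$, and strictly decreasing on $(-\infty,0]$ or strictly increasing on $[0,\infty)$; put $\Phi(t)=\max\{\phi(t),\phi(-t)\}$ for $t\ge 0$ and assume $\lim_{t\to\infty}\Phi(t)/t=+\infty$. For an open set $U\subset\mathbb{R}^n$, $L^\Phi(U)$ is the set of Lebesgue measurable $f:U\to\mathbb{R}$ with $\int_U\Phi(|f|/\lambda)\,dx<\infty$ for some $\lambda>0$, and $W^{1,\Phi}(U)$ is the set of weakly differentiable $f\in L^\Phi(U)$ with $|\nabla f|\in L^\Phi(U)$, where $\nabla f$ is the weak gradient. For a bounded open $G\subset\mathbb{R}^n$, $W_0^{1,\Phi}(G)$ is the set of $f\in W^{1,\Phi}(G)$ whose extension $\bar f$ by $0$ outside $G$ belongs to $W^{1,\Phi}(\mathbb{R}^n)$. For $f\in W_0^{1,\Phi}(G)$ and $y\in\mathbb{R}^n$ let $$\|y\|_{f,\phi}=\inf\Big\{\lambda>0:\ \frac1{|G|}\int_G\phi\Big(\frac{y\cdot\nabla f(x)}{\lambda}\Big)dx\le 1\Big\},\qquad B_\phi(f)=\{y\in\mathbb{R}^n:\|y\|_{f,\phi}\le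 1\}.$$ Let $G_i$ ($i=0,1,2,\dots$) be bounded open subsets of $\mathbb{R}^n$ with $\lim_{i\to\infty}|G_i|=|G_0|$, and let $f_i\in W_0^{1,\Phi}(G_i)$, where $f_0$ is not almost everywhere $0$. Suppose that $\bar f_i\rightharpoonup\bar f_0$ weakly in $W^{1,1}(\mathbb{R}^n)$. Then there are a subsequence of $\{B_\phi(f_i)\}_{i\ge1}$, consisting of convex bodies (non-empty compact convex sets), and a convex body $K_0$ with $o\in K_0$, such that this subsequence converges to $K_0$ in the Hausdorff distance, and $$K_0\subset B_\phi(f_0).$$ -/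

import Mathlib

open MeasureTheory Filter Topology Set
open scoped ContDiff

/-- Euclidean `n`-space. -/
abbrev Eucl (n : ℕ) : Type := EuclideanSpace ℝ (Fin n)

/-- The class `𝒩` of convex functions `φ : ℝ → [0, ∞)` with `φ 0 = 0` that are strictly decreasing
on `(-∞, 0]` or strictly increasing on `[0, ∞)`. -/
structure IsClassN (φ : ℝ → ℝ) : Prop where
  convexOn : ConvexOn ℝ univ φ
  nonneg : ∀ t, 0 ≤ φ t
  map_zero : φ 0 = 0
  strict : StrictAntiOn φ (Iic 0) ∨ StrictMonoOn φ (Ici 0)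

/-- `Φ(t) = max {φ(t), φ(-t)}` (used for `t ≥ 0`). -/
def orliczPhi (φ : ℝ → ℝ) (t : ℝ) : ℝ := max (φ t) (φ (-t))

/-- `Φ(t) / t → ∞` as `t → ∞`. -/
def IsSuperlinear (φ : ℝ → ℝ) : Prop :=
  Tendsto (fun t : ℝ => orliczPhi φ t / t) atTop atTop

/-- `g` is a weak gradient of `f` on the open set `U`: both are locally integrable on `U`, and
`∫_U f ∂_v ψ = - ∫_U ψ (g ⬝ v)` for all directions `v` and all `ψ ∈ C_c^∞(U)`. -/
structure HasWeakGradient {n : ℕ} (U : Set (Eucl n)) (f : Eucl n → ℝ) (g : Eucl n → Eucl n) :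
    Prop where
  locInt : LocallyIntegrableOn f U volume
  locInt_grad : LocallyIntegrableOn g U volume
  integral_eq : ∀ ψ : Eucl n → ℝ, ContDiff ℝ ∞ ψ → HasCompactSupport ψ → tsupport ψ ⊆ U →
    ∀ v : Eucl n,
      ∫ x in U, f x * fderiv ℝ ψ x v = - ∫ x in U, ψ x * inner ℝ (g x) v

/-- `f` is weakly differentiable on `U`. -/
def WeaklyDifferentiable {n : ℕ} (U : Set (Eucl n)) (f : Eucl n → ℝ) : Prop :=
  ∃ g, HasWeakGradient U f g

open scoped Classical in
/-- The weak gradient of `f` on `U` (determined up to null sets of `U` when `f` is weakly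
differentiable on the open set `U`). -/
noncomputable def weakGradient {n : ℕ} (U : Set (Eucl n)) (f : Eucl n → ℝ) : Eucl n → Eucl n :=
  if h : WeaklyDifferentiable U f then h.choose else 0

/-- Membership in the Orlicz space `L^Φ(U)`. -/
def MemOrlicz {n : ℕ} (φ : ℝ → ℝ) (U : Set (Eucl n)) (f : Eucl n → ℝ) : Prop :=
  AEMeasurable f (volume.restrict U) ∧
    ∃ c : ℝ, 0 < c ∧ ∫⁻ x in U, ENNReal.ofReal (orliczPhi φ (|f x| / c)) < ⊤

/-- Membership in the Orlicz-Sobolev space `W^{1,Φ}(U)`. -/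
def MemOrliczSobolev {n : ℕ} (φ : ℝ → ℝ) (U : Set (Eucl n)) (f : Eucl n → ℝ) : Prop :=
  MemOrlicz φ U f ∧ WeaklyDifferentiable U f ∧ MemOrlicz φ U (fun x => ‖weakGradient U f x‖)

/-- Membership in `W_0^{1,Φ}(G)`: functions in `W^{1,Φ}(G)` whose extension by zero lies in
`W^{1,Φ}(ℝⁿ)`. Only the values of `f` on `G` matter; `G.indicator f` is the extension by zero. -/
def MemOrliczSobolevZero {n : ℕ} (φ : ℝ → ℝ) (G : Set (Eucl n)) (f : Eucl n → ℝ) : Prop :=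
  MemOrliczSobolev φ G f ∧ MemOrliczSobolev φ univ (G.indicator f)

/-- `‖y‖_{f,φ} = inf {c > 0 : |G|⁻¹ ∫_G φ(y ⬝ ∇f(x) / c) dx ≤ 1}`. -/
noncomputable def affineNorm {n : ℕ} (φ : ℝ → ℝ) (G : Set (Eucl n)) (f : Eucl n → ℝ)
    (y : Eucl n) : ℝ :=
  sInf {c : ℝ | 0 < c ∧
    (volume G)⁻¹ * ∫⁻ x in G, ENNReal.ofReal (φ (inner ℝ y (weakGradient G f x) / c)) ≤ 1}

/-- The Orlicz-Sobolev affine ball `B_φ(f)` of `f` on `G`. -/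
def affineBall {n : ℕ} (φ : ℝ → ℝ) (G : Set (Eucl n)) (f : Eucl n → ℝ) : Set (Eucl n) :=
  {y | affineNorm φ G f y ≤ 1}

theorem HasWeakGradient.congr_ae {n : ℕ} {U : Set (Eucl n)} {f f' : Eucl n → ℝ}
    {g g' : Eucl n → Eucl n} (h : HasWeakGradient U f g) (hf : f =ᵐ[volume] f')
    (hg : g =ᵐ[volume] g') : HasWeakGradient U f' g' where
  locInt := fun x hx => by
    obtain ⟨s, hs, hi⟩ := h.locInt x hx
    exact ⟨s, hs, hi.congr_fun_ae (ae_restrict_of_ae hf)⟩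
  locInt_grad := fun x hx => by
    obtain ⟨s, hs, hi⟩ := h.locInt_grad x hx
    exact ⟨s, hs, hi.congr_fun_ae (ae_restrict_of_ae hg)⟩
  integral_eq := fun ψ h1 h2 h3 v => by
    have e1 : ∫ x in U, f' x * fderiv ℝ ψ x v = ∫ x in U, f x * fderiv ℝ ψ x v :=
      integral_congr_ae (ae_restrict_of_ae (hf.mono fun x hx => by simp only [hx]))
    have e2 : ∫ x in U, ψ x * inner ℝ (g' x) v = ∫ x in U, ψ x * inner ℝ (g x) v :=
      integral_congr_ae (ae_restrict_of_ae (hg.mono fun x hx => by simp only [hx]))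
    rw [e1, e2, h.integral_eq ψ h1 h2 h3 v]

theorem HasWeakGradient.add_univ {n : ℕ} {f f' : Eucl n → ℝ} {g g' : Eucl n → Eucl n}
    (h : HasWeakGradient univ f g) (h' : HasWeakGradient univ f' g') :
    HasWeakGradient univ (f + f') (g + g') where
  locInt := locallyIntegrableOn_univ.2
    ((locallyIntegrableOn_univ.1 h.locInt).add (locallyIntegrableOn_univ.1 h'.locInt))
  locInt_grad := locallyIntegrableOn_univ.2
    ((locallyIntegrableOn_univ.1 h.locInt_grad).add (locallyIntegrableOn_univ.1 h'.locInt_grad))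
  integral_eq := fun ψ h1 h2 h3 v => by
    have hc : Continuous fun x => fderiv ℝ ψ x v :=
      (h1.continuous_fderiv (by simp)).clm_apply continuous_const
    have hs : HasCompactSupport fun x => fderiv ℝ ψ x v := h2.fderiv_apply ℝ v
    have i1 : ∀ {k : Eucl n → ℝ}, LocallyIntegrableOn k univ volume →
        Integrable (fun x => k x * fderiv ℝ ψ x v) volume := fun hk =>
      (locallyIntegrableOn_univ.1 hk).integrable_smul_right_of_hasCompactSupport hc hs
    have i2 : ∀ {k : Eucl n → Eucl n}, LocallyIntegrableOn k univ volume →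
        Integrable (fun x => ψ x * inner ℝ (k x) v) volume := fun hk => by
      have := ((locallyIntegrableOn_univ.1 hk).integrable_smul_left_of_hasCompactSupport
        h1.continuous h2).inner_const (𝕜 := ℝ) v
      simpa [inner_smul_left] using this
    have e := h.integral_eq ψ h1 h2 h3 v
    have e' := h'.integral_eq ψ h1 h2 h3 v
    simp only [Measure.restrict_univ, Pi.add_apply, add_mul, inner_add_left, mul_add] at e e' ⊢
    rw [integral_add (i1 h.locInt) (i1 h'.locInt), integral_add (i2 h.locInt_grad)
      (i2 h'.locInt_grad), e, e', neg_add]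

theorem HasWeakGradient.smul_univ {n : ℕ} {f : Eucl n → ℝ} {g : Eucl n → Eucl n}
    (h : HasWeakGradient univ f g) (a : ℝ) : HasWeakGradient univ (a • f) (a • g) where
  locInt := locallyIntegrableOn_univ.2 ((locallyIntegrableOn_univ.1 h.locInt).smul a)
  locInt_grad := locallyIntegrableOn_univ.2 ((locallyIntegrableOn_univ.1 h.locInt_grad).smul a)
  integral_eq := fun ψ h1 h2 h3 v => by
    have e := h.integral_eq ψ h1 h2 h3 v
    simp only [Pi.smul_apply, smul_eq_mul, real_inner_smul_left, mul_assoc, mul_left_comm _ a,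
      integral_const_mul, e, mul_neg]

/-- The Sobolev space `W^{1,1}(ℝⁿ)`, as the space of pairs `(u, ∇u)` in `L¹(ℝⁿ) × L¹(ℝⁿ; ℝⁿ)`, with
the norm `‖u‖₁ + ‖∇u‖₁`. -/
noncomputable def SobolevW11 (n : ℕ) :
    Submodule ℝ (WithLp 1 (Lp ℝ 1 (volume : Measure (Eucl n)) ×
      Lp (Eucl n) 1 (volume : Measure (Eucl n)))) where
  carrier := {p | HasWeakGradient univ p.fst p.snd}
  zero_mem' := by
    have h : HasWeakGradient (univ : Set (Eucl n)) 0 0 :=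
      ⟨by intro x _; exact ⟨univ, univ_mem, integrableOn_zero⟩,
        by intro x _; exact ⟨univ, univ_mem, integrableOn_zero⟩, by intros; simp⟩
    exact h.congr_ae (Lp.coeFn_zero ..).symm (Lp.coeFn_zero ..).symm
  add_mem' := fun {p q} hp hq =>
    (HasWeakGradient.add_univ hp hq).congr_ae (Lp.coeFn_add p.fst q.fst).symm
      (Lp.coeFn_add p.snd q.snd).symm
  smul_mem' := fun a p hp =>
    (HasWeakGradient.smul_univ hp a).congr_ae (Lp.coeFn_smul a p.fst).symm
      (Lp.coeFn_smul a p.snd).symm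

/-- Weak convergence of `F i` to `F₀` in the Banach space `W^{1,1}(ℝⁿ)` (functions being identified
with their classes modulo null sets): convergence in the weak topology of the normed space. -/
def WeaklyConvergesW11 {n : ℕ} (F : ℕ → Eucl n → ℝ) (F₀ : Eucl n → ℝ) : Prop :=
  ∃ (u : ℕ → SobolevW11 n) (u₀ : SobolevW11 n),
    (∀ i, ((u i).1.fst : Eucl n → ℝ) =ᵐ[volume] F i) ∧
    (u₀.1.fst : Eucl n → ℝ) =ᵐ[volume] F₀ ∧
    Tendsto (fun i => toWeakSpace ℝ (SobolevW11 n) (u i)) atTop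
      (𝓝 (toWeakSpace ℝ (SobolevW11 n) u₀))

/-!
Write `J_i(y) = ∫ φ(y ⬝ ∇f̄_i)` for the modular of the gradient of the extension by zero, taken over
the whole space. The argument consists of four facts.

* **The gradient lives on `G_i`.** `∇f̄_i` agrees with `∇f_i` on `G_i` and vanishes almost everywhere
  off `G_i`, also on `∂G_i`, which may have positive measure
  (`HasWeakGradient.ae_eq_of_indicator`, `HasWeakGradient.ae_eq_zero_of_notMem`). The second claim
  comes from the fundamental theorem of calculus along almost every segment
  (`IsWeakDirDeriv.ae_translate_sub_eq`) and the continuity of translations in `L¹`. Hence the ball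
  of `f_i` is the sublevel set `{J_i ≤ |G_i|}` (`affineBall_eq`), which is closed and convex and
  contains the origin.
* **Lower semicontinuity.** A sublevel set of the convex functional `∫ φ(w)` on `L¹` is convex, and
  closed by Fatou's lemma, so it is weakly closed. As `y_i ⬝ ∇f̄_i` converges weakly to
  `y ⬝ ∇f̄_0` when `y_i → y`, bounds `J_i(y_i) ≤ a_i` with `a_i → a` give `J_0(y) ≤ a`
  (`dirModular_le_of_tendsto`).
* **Uniform boundedness.** For `z ≠ 0` the function `z ⬝ ∇f̄_0` has integral zero and is not zero
  almost everywhere, as otherwise `f̄_0` would be invariant under translations along `z`. So it takes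
  both signs and `J_0(z) > 0` (`dirModular_ne_zero`). If points `y_i` of the balls went to infinity,
  a limit `z` of `y_i / ‖y_i‖` would satisfy `J_0(z) = 0`, since convexity gives
  `J_i(y_i / ‖y_i‖) ≤ |G_i| / ‖y_i‖` (`exists_eventually_norm_le_of_dirModular_le`).
* **Selection.** Blaschke's theorem (`ConvexBody.exists_subseq_tendsto`) provides a convergent
  subsequence; each point of the limit is a limit of points of the balls, so lower semicontinuity
  with `a_i = |G_i|` puts it into the ball of `f_0`.
-/

/-! ### Weak directional derivatives -/

/-- `w` is the weak derivative of `u` in the direction `v`, on the whole space. -/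
def IsWeakDirDeriv {n : ℕ} (v : Eucl n) (u w : Eucl n → ℝ) : Prop :=
  ∀ ψ : Eucl n → ℝ, ContDiff ℝ ∞ ψ → HasCompactSupport ψ →
    ∫ x, u x * fderiv ℝ ψ x v = - ∫ x, ψ x * w x

theorem HasWeakGradient.isWeakDirDeriv {n : ℕ} {u : Eucl n → ℝ} {g : Eucl n → Eucl n}
    (h : HasWeakGradient univ u g) (v : Eucl n) :
    IsWeakDirDeriv v u (fun x => inner ℝ v (g x)) := by
  intro ψ h1 h2
  have := h.integral_eq ψ h1 h2 (subset_univ _) v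
  simpa only [Measure.restrict_univ, real_inner_comm v] using this

theorem IsWeakDirDeriv.smul {n : ℕ} {v : Eucl n} {u w : Eucl n → ℝ}
    (h : IsWeakDirDeriv v u w) (c : ℝ) : IsWeakDirDeriv (c • v) u (fun x => c * w x) := by
  intro ψ h1 h2
  simp only [map_smul, smul_eq_mul, mul_left_comm _ c, integral_const_mul, h ψ h1 h2, mul_neg]

theorem integral_translate_mul {n : ℕ} (a : Eucl n) (f k : Eucl n → ℝ) :
    ∫ x, f (x - a) * k x = ∫ x, f x * k (x + a) := by
  rw [← integral_add_right_eq_self (fun x => f (x - a) * k x) a]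
  simp

/-- The translation of an integrable function is integrable jointly with the translation
parameter. -/
theorem integrable_translate_prod {n : ℕ} {w : Eucl n → ℝ} (hw : Integrable w) (v : Eucl n)
    (μ : Measure ℝ) [IsFiniteMeasure μ] :
    Integrable (fun p : ℝ × Eucl n => w (p.2 + p.1 • v)) (μ.prod volume) := by
  have hm : MeasurePreserving (fun p : ℝ × Eucl n => (p.1, p.2 + p.1 • v))
      (μ.prod volume) (μ.prod volume) :=
    (MeasurePreserving.id μ).skew_product (g := fun t x => x + t • v) (by fun_prop)
      (Eventually.of_forall fun t => (measurePreserving_add_right volume (t • v)).map_eq)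
  exact hm.integrable_comp_of_integrable (hw.comp_snd μ)

theorem integral_fderiv_translate {n : ℕ} {ψ : Eucl n → ℝ} (hψ : ContDiff ℝ ∞ ψ) (x v : Eucl n) :
    ψ (x - v) - ψ x = - ∫ t in (0 : ℝ)..1, fderiv ℝ ψ (x - t • v) v := by
  have hc : Continuous fun t : ℝ => fderiv ℝ ψ (x - t • v) v := by
    have := hψ.continuous_fderiv (by simp)
    fun_prop
  have hd : ∀ t ∈ uIcc (0 : ℝ) 1, HasDerivAt (fun t : ℝ => ψ (x - t • v))
      (-(fderiv ℝ ψ (x - t • v) v)) t := by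
    intro t _
    have h1 : HasDerivAt (fun t : ℝ => x - t • v) (-v) t := by
      simpa using ((hasDerivAt_id t).smul_const v).const_sub x
    have h2 := (hψ.differentiable (by simp) (x - t • v)).hasFDerivAt.comp_hasDerivAt t h1
    simpa [Function.comp_def] using h2
  have := intervalIntegral.integral_eq_sub_of_hasDerivAt hd (hc.neg.intervalIntegrable _ _)
  simpa using this.symm

/-- An integrable function with integrable weak derivative satisfies the fundamental theorem of
calculus along almost every segment parallel to `v`. -/
theorem IsWeakDirDeriv.ae_translate_sub_eq {n : ℕ} {v : Eucl n} {u w : Eucl n → ℝ}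
    (h : IsWeakDirDeriv v u w) (hu : Integrable u) (hw : Integrable w) :
    ∀ᵐ x, u (x + v) - u x = ∫ t in (0 : ℝ)..1, w (x + t • v) := by
  have hwp := integrable_translate_prod hw v (volume.restrict (Ioc (0 : ℝ) 1))
  have hW : Integrable (fun x => ∫ t in (0 : ℝ)..1, w (x + t • v)) := by
    simp only [intervalIntegral.integral_of_le zero_le_one]
    exact hwp.integral_prod_right
  have huv : Integrable (fun x => u (x + v)) := hu.comp_add_right v
  refine ae_eq_of_integral_contDiff_smul_eq (huv.sub hu).locallyIntegrable
    hW.locallyIntegrable fun ψ h1 h2 => ?_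
  obtain ⟨C, hC⟩ := h2.exists_bound_of_continuous h1.continuous
  have hdc : Continuous (fun x => fderiv ℝ ψ x v) :=
    (h1.continuous_fderiv (by simp)).clm_apply continuous_const
  obtain ⟨D, hD⟩ := (h2.fderiv_apply ℝ v).exists_bound_of_continuous hdc
  have i1 : ∀ {k : Eucl n → ℝ}, Integrable k → Integrable (fun x => ψ x * k x) := fun hk =>
    hk.bdd_mul h1.continuous.aestronglyMeasurable (Eventually.of_forall hC)
  have hψv : ∀ a : Eucl n, Integrable (fun x => ψ (x - a) * u x) := fun a =>
    hu.bdd_mul (by have := h1.continuous; fun_prop) (Eventually.of_forall fun x => hC (x - a))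
  -- test against `ψ` and move the translation to the test function
  calc ∫ x, ψ x • (u (x + v) - u x)
      = ∫ x, u x * (ψ (x - v) - ψ x) := by
        simp only [smul_eq_mul, mul_sub]
        rw [integral_sub (i1 huv) (i1 hu), integral_sub, ← integral_translate_mul]
        · simp only [mul_comm]
        · simpa only [mul_comm] using hψv v
        · simpa only [mul_comm] using i1 hu
    _ = ∫ x, - ∫ t in Ioc (0 : ℝ) 1, u x * fderiv ℝ ψ (x - t • v) v := by
        congr 1; ext x
        rw [integral_fderiv_translate h1, intervalIntegral.integral_of_le zero_le_one,
          integral_const_mul, mul_neg]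
    _ = - ∫ t in Ioc (0 : ℝ) 1, ∫ x, u x * fderiv ℝ ψ (x - t • v) v := by
        rw [integral_neg, integral_integral_swap]
        have hi : Integrable (fun p : Eucl n × ℝ => u p.1)
            (volume.prod (volume.restrict (Ioc (0 : ℝ) 1))) := hu.comp_fst _
        refine (hi.bdd_mul (f := fun p : Eucl n × ℝ => fderiv ℝ ψ (p.1 - p.2 • v) v) (c := D)
          ?_ (Eventually.of_forall fun p => hD _)).congr
          (Eventually.of_forall fun p => mul_comm _ _)
        exact (hdc.comp (by fun_prop : Continuous fun p : Eucl n × ℝ =>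
          p.1 - p.2 • v)).aestronglyMeasurable
    _ = ∫ t in Ioc (0 : ℝ) 1, ∫ x, ψ x * w (x + t • v) := by
        rw [← integral_neg]
        congr 1; ext t
        have h3 := h (fun x => ψ (x - t • v)) (h1.comp (contDiff_id.sub contDiff_const))
          (h2.comp_homeomorph (Homeomorph.subRight (t • v)))
        simp only [fderiv_comp_sub] at h3
        rw [h3, neg_neg, integral_translate_mul]
    _ = ∫ x, ∫ t in Ioc (0 : ℝ) 1, ψ x * w (x + t • v) := by
        refine integral_integral_swap ?_
        refine hwp.bdd_mul (f := fun p : ℝ × Eucl n => ψ p.2) (c := C) ?_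
          (Eventually.of_forall fun p => hC _)
        exact (h1.continuous.comp continuous_snd).aestronglyMeasurable
    _ = ∫ x, ψ x • ∫ t in (0 : ℝ)..1, w (x + t • v) := by
        simp only [intervalIntegral.integral_of_le zero_le_one, smul_eq_mul, integral_const_mul]

/-- Translation is continuous in `L¹`. -/
theorem tendsto_lintegral_translate_sub {n : ℕ} {w : Eucl n → ℝ} (hw : Integrable w) :
    Tendsto (fun a : Eucl n => ∫⁻ x, ‖w (x + a) - w x‖ₑ) (𝓝 0) (𝓝 0) := by
  let W : Lp ℝ 1 (volume : Measure (Eucl n)) := hw.toL1 w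
  have : Fact ((1 : ENNReal) ≠ ⊤) := ⟨ENNReal.one_ne_top⟩
  have hc : Continuous fun a : Eucl n => (DomAddAct.mk a +ᵥ W) :=
    (DomAddAct.continuous_mk).vadd continuous_const
  have ht : Tendsto (fun a : Eucl n => edist (DomAddAct.mk a +ᵥ W) W) (𝓝 0) (𝓝 0) := by
    have := (hc.edist continuous_const : Continuous fun a => edist (DomAddAct.mk a +ᵥ W) W).tendsto
      0
    simpa using this
  refine ht.congr fun a => ?_
  rw [Lp.edist_def, eLpNorm_one_eq_lintegral_enorm]
  refine lintegral_congr_ae ?_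
  have e1 : ∀ᵐ x, W x = w x := hw.coeFn_toL1
  have e2 : ∀ᵐ x, W (a + x) = w (a + x) :=
    (measurePreserving_add_left volume a).quasiMeasurePreserving.ae e1
  filter_upwards [DomAddAct.vadd_Lp_ae_eq (DomAddAct.mk a) W, e1, e2] with x h1 h2 h3
  rw [Pi.sub_apply, h1, h2, Equiv.symm_apply_apply, vadd_eq_add, h3, add_comm]

/-! ### Vanishing of weak derivatives, and uniqueness of weak gradients -/

/-- The mass of an integrable function on the points of an open set `G` that a translation by `-a`
moves out of `G` tends to zero as `a → 0`, because these points escape `G` only near its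
boundary. -/
theorem tendsto_lintegral_indicator_translate {n : ℕ} {G : Set (Eucl n)} (hG : IsOpen G)
    {w : Eucl n → ℝ} (hw : Integrable w) :
    Tendsto (fun a : Eucl n => ∫⁻ x, {x | x ∈ G ∧ x - a ∉ G}.indicator (fun x => ‖w x‖ₑ) x)
      (𝓝 0) (𝓝 0) := by
  have hms : ∀ a : Eucl n, MeasurableSet {x | x ∈ G ∧ x - a ∉ G} := fun a =>
    hG.measurableSet.inter ((measurable_sub_const a) hG.measurableSet.compl)
  have h := tendsto_lintegral_filter_of_dominated_convergence' (μ := (volume : Measure (Eucl n)))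
    (l := 𝓝 (0 : Eucl n))
    (F := fun a x => {x | x ∈ G ∧ x - a ∉ G}.indicator (fun x => ‖w x‖ₑ) x) (f := fun _ => 0)
    (fun x => ‖w x‖ₑ) (Eventually.of_forall fun a => hw.1.enorm.indicator (hms a))
    (Eventually.of_forall fun a => Eventually.of_forall fun x => indicator_le_self _ _ x)
    hw.2.ne (Eventually.of_forall fun x => ?_)
  · simpa using h
  · refine tendsto_const_nhds.congr' ?_
    by_cases hx : x ∈ G
    · have hc : Tendsto (fun a : Eucl n => x - a) (𝓝 0) (𝓝 x) := by
        simpa using (tendsto_const_nhds (x := x)).sub (tendsto_id (x := 𝓝 (0 : Eucl n)))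
      filter_upwards [hc (hG.mem_nhds hx)] with a ha
      rw [indicator_of_notMem]
      exact fun h => h.2 ha
    · exact Eventually.of_forall fun a => (indicator_of_notMem (fun h => hx h.1) _).symm

/-- Where both `x` and `x + a` lie outside the set carrying `u`, the mean of the derivative over the
segment between them vanishes, so that `w x` is controlled by the oscillation of `w`. -/
theorem IsWeakDirDeriv.ae_enorm_le {n : ℕ} {v : Eucl n} {u w : Eucl n → ℝ} {G : Set (Eucl n)}
    (h : IsWeakDirDeriv v u w) (hu : Integrable u) (hw : Integrable w)
    (hu0 : ∀ᵐ x, x ∉ G → u x = 0) {c : ℝ} (hc : c ≠ 0) :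
    ∀ᵐ x, x ∉ G → x + c • v ∉ G →
      ‖w x‖ₑ ≤ ∫⁻ t in Ioc (0 : ℝ) 1, ‖w (x + t • c • v) - w x‖ₑ := by
  have h1 := (h.smul c).ae_translate_sub_eq hu (hw.const_mul c)
  have h2 : ∀ᵐ x, x + c • v ∉ G → u (x + c • v) = 0 :=
    (measurePreserving_add_right volume (c • v)).quasiMeasurePreserving.ae hu0
  have h3 := (integrable_translate_prod hw (c • v)
    (volume.restrict (Ioc (0 : ℝ) 1))).prod_left_ae
  filter_upwards [hu0, h1, h2, h3] with x hx0 hx1 hx2 hx3 hxG hxG'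
  rw [hx0 hxG, hx2 hxG', sub_zero, intervalIntegral.integral_of_le zero_le_one,
    integral_const_mul] at hx1
  have hz : ∫ t in Ioc (0 : ℝ) 1, w (x + t • c • v) = 0 := by
    simpa [hc] using hx1.symm
  have he : w x = - ∫ t in Ioc (0 : ℝ) 1, (w (x + t • c • v) - w x) := by
    rw [integral_sub hx3 (integrable_const _), hz]
    simp
  calc ‖w x‖ₑ = ‖∫ t in Ioc (0 : ℝ) 1, (w (x + t • c • v) - w x)‖ₑ := by
        conv_lhs => rw [he, enorm_neg]
    _ ≤ _ := enorm_integral_le_lintegral_enorm _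

/-- The weak derivative of an integrable function vanishes almost everywhere off every open set
that carries the function, even on the boundary, which may have positive measure. -/
theorem IsWeakDirDeriv.ae_eq_zero_of_notMem {n : ℕ} {v : Eucl n} {u w : Eucl n → ℝ}
    {G : Set (Eucl n)} (hG : IsOpen G) (h : IsWeakDirDeriv v u w) (hu : Integrable u)
    (hw : Integrable w) (hu0 : ∀ᵐ x, x ∉ G → u x = 0) : ∀ᵐ x, x ∉ G → w x = 0 := by
  have hGm := hG.measurableSet
  set T : Eucl n → ENNReal := fun a => ∫⁻ x, ‖w (x + a) - w x‖ₑ with hT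
  set B : Eucl n → ENNReal := fun a =>
    ∫⁻ x, {x | x ∈ G ∧ x - a ∉ G}.indicator (fun x => ‖w x‖ₑ) x with hB
  have hshift : ∀ a, AEMeasurable (fun x => ‖w (x + a) - w x‖ₑ) :=
    fun a => ((hw.comp_add_right a).sub hw).1.enorm
  -- the mass of `w` off `G`, for a translation `a = c • v`
  have key : ∀ c : ℝ, c ≠ 0 → ∫⁻ x in Gᶜ, ‖w x‖ₑ ≤
      (∫⁻ t in Ioc (0 : ℝ) 1, T (t • c • v)) + (T (-(c • v)) + B (c • v)) := by
    intro c hc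
    set a := c • v with ha
    have hmp : AEMeasurable (fun p : ℝ × Eucl n => ‖w (p.2 + p.1 • a) - w p.2‖ₑ)
        ((volume.restrict (Ioc (0 : ℝ) 1)).prod volume) :=
      ((integrable_translate_prod hw a _).sub (hw.comp_snd _)).1.enorm
    have hE : AEMeasurable
        (fun x => ∫⁻ t in Ioc (0 : ℝ) 1, ‖w (x + t • a) - w x‖ₑ) :=
      hmp.lintegral_prod_left'
    have hms : MeasurableSet {x | x ∉ G ∧ x + a ∈ G} :=
      hGm.compl.inter ((measurable_add_const a) hGm)
    have h1 : ∫⁻ x in Gᶜ, ‖w x‖ₑ ≤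
        ∫⁻ x, ((∫⁻ t in Ioc (0 : ℝ) 1, ‖w (x + t • a) - w x‖ₑ) +
          {x | x ∉ G ∧ x + a ∈ G}.indicator (fun x => ‖w x‖ₑ) x) := by
      rw [← lintegral_indicator hGm.compl]
      refine lintegral_mono_ae ?_
      filter_upwards [h.ae_enorm_le hu hw hu0 hc] with x hx
      by_cases hxG : x ∈ G
      · simp [hxG]
      rw [indicator_of_mem (show x ∈ Gᶜ from hxG)]
      by_cases hxa : x + a ∈ G
      · rw [indicator_of_mem (show x ∈ {x | x ∉ G ∧ x + a ∈ G} from ⟨hxG, hxa⟩)]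
        exact le_add_self
      · exact (hx hxG hxa).trans le_self_add
    have h2 : ∫⁻ x, {x | x ∉ G ∧ x + a ∈ G}.indicator (fun x => ‖w x‖ₑ) x ≤ T (-a) + B a := by
      rw [← lintegral_add_right_eq_self _ (-a), hT, hB, ← lintegral_add_left' (hshift (-a))]
      refine lintegral_mono fun x => ?_
      by_cases hx : x ∈ G ∧ x - a ∉ G
      · rw [indicator_of_mem (show x ∈ {x | x ∈ G ∧ x - a ∉ G} from hx)]
        refine (indicator_le_self _ _ _).trans ?_
        calc ‖w (x + -a)‖ₑ = ‖(w (x + -a) - w x) + w x‖ₑ := by rw [sub_add_cancel]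
          _ ≤ _ := enorm_add_le _ _
      · rw [indicator_of_notMem]
        · exact zero_le
        · rintro ⟨h3, h4⟩
          exact hx ⟨by simpa using h4, by simpa [sub_eq_add_neg] using h3⟩
    refine h1.trans ?_
    rw [lintegral_add_left' hE]
    refine add_le_add (le_of_eq ?_) h2
    exact (lintegral_lintegral_swap hmp).symm
  have hzero : ∫⁻ x in Gᶜ, ‖w x‖ₑ = 0 := by
    refine le_antisymm (ENNReal.le_of_forall_pos_le_add fun ε hε _ => ?_) zero_le
    have hε3 : (0 : ENNReal) < ε / 3 := by
      exact ENNReal.div_pos (by exact_mod_cast hε.ne') (by simp)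
    obtain ⟨δ, hδ, hTδ⟩ := Metric.eventually_nhds_iff.1
      (((tendsto_lintegral_translate_sub hw).eventually (gt_mem_nhds hε3)).and
        ((tendsto_lintegral_indicator_translate hG hw).eventually (gt_mem_nhds hε3)))
    have hcv : Tendsto (fun c : ℝ => c • v) (𝓝[≠] 0) (𝓝 0) := by
      have : Tendsto (fun c : ℝ => c • v) (𝓝 0) (𝓝 ((0 : ℝ) • v)) :=
        tendsto_id.smul_const v
      rw [zero_smul] at this
      exact this.mono_left nhdsWithin_le_nhds
    obtain ⟨c, hcδ, hc⟩ := ((hcv.eventually (Metric.ball_mem_nhds 0 hδ)).and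
      self_mem_nhdsWithin).exists
    have hcδ' : ‖c • v‖ < δ := by simpa using hcδ
    have hI : ∫⁻ t in Ioc (0 : ℝ) 1, T (t • c • v) ≤ ε / 3 := by
      calc ∫⁻ t in Ioc (0 : ℝ) 1, T (t • c • v)
          ≤ ∫⁻ t in Ioc (0 : ℝ) 1, (ε / 3 : ENNReal) := by
            refine setLIntegral_mono measurable_const fun t ht => (hTδ ?_).1.le
            rw [dist_zero_right, norm_smul, Real.norm_of_nonneg ht.1.le]
            exact (mul_le_of_le_one_left (norm_nonneg _) ht.2).trans_lt hcδ'
        _ = ε / 3 := by simp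
    refine (key c hc).trans ?_
    rw [zero_add, ← ENNReal.add_thirds ε, add_assoc]
    refine add_le_add hI (add_le_add (hTδ ?_).1.le (hTδ ?_).2.le)
    · simpa using hcδ'
    · simpa using hcδ'
  have hae := (lintegral_eq_zero_iff' hw.1.restrict.enorm).1 hzero
  filter_upwards [(ae_restrict_iff' hGm.compl).1 hae] with x hx hxG
  simpa using hx hxG

/-- A function with bounded support and vanishing derivative in some direction is zero: it is
invariant under translations that move its support off itself. -/
theorem IsWeakDirDeriv.ae_eq_zero_of_bounded {n : ℕ} {v : Eucl n} (hv : v ≠ 0)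
    {u w : Eucl n → ℝ} {R : ℝ} (h : IsWeakDirDeriv v u w) (hu : Integrable u)
    (hw : w =ᵐ[volume] 0) (hu0 : ∀ᵐ x, x ∉ Metric.ball 0 R → u x = 0) : u =ᵐ[volume] 0 := by
  have h0 : IsWeakDirDeriv v u (fun _ => 0) := by
    intro ψ h1 h2
    rw [h ψ h1 h2]
    congr 1
    exact integral_congr_ae (hw.mono fun x hx => by simp [hx])
  obtain ⟨c, hc⟩ : ∃ c : ℝ, 2 * R ≤ ‖c • v‖ := by
    refine ⟨2 * |R| / ‖v‖, ?_⟩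
    rw [norm_smul, norm_div, norm_norm, div_mul_cancel₀ _ (norm_ne_zero_iff.2 hv)]
    simpa using le_abs_self R
  have h1 := (h0.smul c).ae_translate_sub_eq hu (by simp)
  have h2 : ∀ᵐ x, x + c • v ∉ Metric.ball 0 R → u (x + c • v) = 0 :=
    (measurePreserving_add_right volume (c • v)).quasiMeasurePreserving.ae hu0
  filter_upwards [h1, h2, hu0] with x hx1 hx2 hx3
  by_cases hx : x ∈ Metric.ball 0 R
  · have hxv : x + c • v ∉ Metric.ball 0 R := by
      intro hm
      have h3 : ‖c • v‖ ≤ ‖x + c • v‖ + ‖x‖ := by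
        simpa using norm_sub_le (x + c • v) x
      rw [mem_ball_zero_iff] at hm hx
      linarith
    simp only [mul_zero, intervalIntegral.integral_zero, hx2 hxv, zero_sub, neg_eq_zero] at hx1
    exact hx1
  · exact hx3 hx

/-- The weak derivative of a function with bounded support has integral zero: test it against a
cutoff that is constant near the support. -/
theorem IsWeakDirDeriv.integral_eq_zero {n : ℕ} {v : Eucl n} {u w : Eucl n → ℝ} {R : ℝ}
    (hR : 0 < R) (h : IsWeakDirDeriv v u w) (hu0 : ∀ᵐ x, x ∉ Metric.ball 0 R → u x = 0)
    (hw0 : ∀ᵐ x, x ∉ Metric.ball 0 R → w x = 0) : ∫ x, w x = 0 := by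
  let ψ : ContDiffBump (0 : Eucl n) := ⟨R, R + 1, hR, by linarith⟩
  have h1 := h ψ ψ.contDiff ψ.hasCompactSupport
  have e1 : ∫ x, u x * fderiv ℝ ψ x v = 0 := by
    refine integral_eq_zero_of_ae (hu0.mono fun x hx => ?_)
    by_cases hxR : x ∈ Metric.ball 0 R
    · have h2 : fderiv ℝ ψ x = 0 := by
        rw [(ψ.eventuallyEq_one_of_mem_ball hxR).fderiv_eq]
        exact fderiv_const_apply 1
      simp [h2]
    · simp [hx hxR]
  have e2 : ∫ x, ψ x * w x = ∫ x, w x := by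
    refine integral_congr_ae (hw0.mono fun x hx => ?_)
    by_cases hxR : x ∈ Metric.ball 0 R
    · simp [ψ.one_of_mem_closedBall (Metric.ball_subset_closedBall hxR)]
    · simp [hx hxR]
  rw [e1, e2] at h1
  linarith

/-- Vector form of `IsWeakDirDeriv.ae_eq_zero_of_notMem`. -/
theorem HasWeakGradient.ae_eq_zero_of_notMem {n : ℕ} {u : Eucl n → ℝ} {g : Eucl n → Eucl n}
    {G : Set (Eucl n)} (hG : IsOpen G) (h : HasWeakGradient univ u g) (hu : Integrable u)
    (hg : Integrable g) (hu0 : ∀ᵐ x, x ∉ G → u x = 0) : ∀ᵐ x, x ∉ G → g x = 0 := by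
  have hi : ∀ i : Fin n, ∀ᵐ x, x ∉ G → inner ℝ (EuclideanSpace.single i (1 : ℝ)) (g x) = 0 :=
    fun i => (h.isWeakDirDeriv _).ae_eq_zero_of_notMem hG hu (hg.const_inner _) hu0
  filter_upwards [ae_all_iff.2 hi] with x hx hxG
  ext i
  simpa [EuclideanSpace.inner_single_left] using hx i hxG

/-- Weak gradients on an open set are unique: the one of the extension by zero restricts to the one
on `G`. -/
theorem HasWeakGradient.ae_eq_of_indicator {n : ℕ} {u f : Eucl n → ℝ} {g k : Eucl n → Eucl n}
    {G : Set (Eucl n)} (hG : IsOpen G) (h : HasWeakGradient univ u g)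
    (hu : u =ᵐ[volume] G.indicator f) (hk : HasWeakGradient G f k) :
    ∀ᵐ x, x ∈ G → g x = k x := by
  have hgl : LocallyIntegrableOn g G volume := h.locInt_grad.mono_set (subset_univ G)
  suffices hi : ∀ i : Fin n, ∀ᵐ x, x ∈ G → (g x - k x) i = 0 by
    filter_upwards [ae_all_iff.2 hi] with x hx hxG
    ext i
    simpa [sub_eq_zero] using hx i hxG
  intro i
  set v : Eucl n := EuclideanSpace.single i (1 : ℝ) with hv
  have hvi : ∀ y : Eucl n, inner ℝ y v = y i := fun y => by
    simp [hv, EuclideanSpace.inner_single_right]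
  have hloc : LocallyIntegrableOn (fun x => (g x - k x) i) G volume := by
    intro x hx
    obtain ⟨s, hs, his⟩ := (hgl.sub hk.locInt_grad) x hx
    refine ⟨s, hs, ?_⟩
    have := Integrable.inner_const (𝕜 := ℝ) his v
    exact this.congr (Eventually.of_forall fun x => hvi _)
  refine hG.ae_eq_zero_of_integral_contDiff_smul_eq_zero hloc fun ψ h1 h2 h3 => ?_
  have hz : ∀ x, x ∉ G → ψ x = 0 := fun x hx => image_eq_zero_of_notMem_tsupport fun hm => hx (h3 hm)
  have hz' : ∀ x, x ∉ G → fderiv ℝ ψ x v = 0 := fun x hx => by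
    have : x ∉ tsupport (fderiv ℝ ψ) := fun hm => hx (h3 (tsupport_fderiv_subset ℝ hm))
    simp [image_eq_zero_of_notMem_tsupport this]
  have e1 := h.integral_eq ψ h1 h2 (subset_univ _) v
  have e2 := hk.integral_eq ψ h1 h2 h3 v
  simp only [Measure.restrict_univ, hvi] at e1 e2
  have e3 : ∫ x, u x * fderiv ℝ ψ x v = ∫ x in G, f x * fderiv ℝ ψ x v := by
    rw [← integral_indicator hG.measurableSet]
    refine integral_congr_ae (hu.mono fun x hx => ?_)
    by_cases hxG : x ∈ G
    · simp [hx, hxG]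
    · simp [hxG, hz' x hxG]
  have e4 : ∫ x in G, ψ x * k x i = ∫ x, ψ x * k x i :=
    setIntegral_eq_integral_of_forall_compl_eq_zero fun x hx => by simp [hz x hx]
  have hint : ∀ {q : Eucl n → Eucl n}, LocallyIntegrableOn q G volume →
      Integrable (fun x => ψ x * q x i) := fun {q} hq => by
    have h5 : IntegrableOn q (tsupport ψ) := hq.integrableOn_compact_subset h3 h2
    obtain ⟨C, hC⟩ := h2.exists_bound_of_continuous h1.continuous
    have h6 : IntegrableOn (fun x => ψ x * q x i) (tsupport ψ) := by
      have h7 : IntegrableOn (fun x => q x i) (tsupport ψ) :=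
        (Integrable.inner_const (𝕜 := ℝ) h5 v).congr (Eventually.of_forall fun x => hvi _)
      exact Integrable.bdd_mul h7 h1.continuous.aestronglyMeasurable (Eventually.of_forall hC)
    rw [integrableOn_iff_integrable_of_support_subset] at h6
    · exact h6
    · intro x hx
      exact subset_tsupport _ (left_ne_zero_of_mul hx)
  have e5 : ∫ x, ψ x * g x i = ∫ x, ψ x * k x i := by
    rw [e3, e2, e4] at e1
    linarith
  simp only [smul_eq_mul, PiLp.sub_apply, mul_sub]
  rw [integral_sub (hint hgl) (hint hk.locInt_grad), e5, sub_self]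

/-! ### Convex integral functionals and weak convergence -/

namespace IsClassN

variable {φ : ℝ → ℝ}

theorem continuous (hφ : IsClassN φ) : Continuous φ :=
  continuousOn_univ.1 (hφ.convexOn.continuousOn isOpen_univ)

theorem map_mul_le (hφ : IsClassN φ) {s : ℝ} (hs0 : 0 ≤ s) (hs1 : s ≤ 1) (t : ℝ) :
    φ (s * t) ≤ s * φ t := by
  have := hφ.convexOn.2 (mem_univ t) (mem_univ 0) hs0 (sub_nonneg.2 hs1) (by ring)
  simpa [hφ.map_zero] using this

/-- `φ` is controlled by `Φ` in the quantitative form that lets the modular be made small. -/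
theorem map_le_mul_orliczPhi (hφ : IsClassN φ) {ε s t : ℝ} (hε0 : 0 ≤ ε) (hε : ε ≤ 1)
    (hs : |s| ≤ ε * t) : φ s ≤ ε * orliczPhi φ t := by
  have hP : 0 ≤ orliczPhi φ t := (hφ.nonneg t).trans (le_max_left _ _)
  have ht : 0 ≤ ε * t := (abs_nonneg s).trans hs
  rcases eq_or_lt_of_le ht with h0 | h0
  · have : s = 0 := abs_eq_zero.1 (le_antisymm (hs.trans h0.ge) (abs_nonneg s))
    rw [this, hφ.map_zero]
    positivity
  have ht' : 0 < t := pos_of_mul_pos_right h0 hε0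
  have hq : |s| / t ≤ ε := by rwa [div_le_iff₀ ht']
  have hq0 : 0 ≤ |s| / t := by positivity
  have hm : φ s ≤ |s| / t * orliczPhi φ t := by
    rcases le_total 0 s with h | h
    · have h1 := hφ.map_mul_le hq0 (hq.trans hε) t
      rw [div_mul_cancel₀ _ ht'.ne', abs_of_nonneg h] at h1
      rw [abs_of_nonneg h] at hq0 ⊢
      exact h1.trans (mul_le_mul_of_nonneg_left (le_max_left _ _) hq0)
    · have h1 := hφ.map_mul_le hq0 (hq.trans hε) (-t)
      rw [mul_neg, div_mul_cancel₀ _ ht'.ne', abs_of_nonpos h, neg_neg] at h1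
      rw [abs_of_nonpos h] at hq0 ⊢
      exact h1.trans (mul_le_mul_of_nonneg_left (le_max_right _ _) hq0)
  exact hm.trans (mul_le_mul_of_nonneg_right hq hP)

theorem ofReal_map_combo_le (hφ : IsClassN φ) {a b : ℝ} (ha : 0 ≤ a) (hb : 0 ≤ b)
    (hab : a + b = 1) (s t : ℝ) :
    ENNReal.ofReal (φ (a * s + b * t)) ≤
      ENNReal.ofReal a * ENNReal.ofReal (φ s) + ENNReal.ofReal b * ENNReal.ofReal (φ t) := by
  rw [← ENNReal.ofReal_mul ha, ← ENNReal.ofReal_mul hb, ← ENNReal.ofReal_add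
    (mul_nonneg ha (hφ.nonneg s)) (mul_nonneg hb (hφ.nonneg t))]
  exact ENNReal.ofReal_le_ofReal (hφ.convexOn.2 (mem_univ s) (mem_univ t) ha hb hab)

end IsClassN

theorem convex_setOf_lintegral_le {α : Type*} [MeasurableSpace α] {μ : Measure α} {φ : ℝ → ℝ}
    (hφ : IsClassN φ) (c : ENNReal) :
    Convex ℝ {w : Lp ℝ 1 μ | ∫⁻ x, ENNReal.ofReal (φ (w x)) ∂μ ≤ c} := by
  intro w hw z hz a b ha hb hab
  have hm : ∀ q : Lp ℝ 1 μ, AEMeasurable (fun x => ENNReal.ofReal (φ (q x))) μ := fun q =>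
    (hφ.continuous.measurable.comp_aemeasurable (Lp.aestronglyMeasurable q).aemeasurable).ennreal_ofReal
  calc ∫⁻ x, ENNReal.ofReal (φ ((a • w + b • z : Lp ℝ 1 μ) x)) ∂μ
      ≤ ∫⁻ x, (ENNReal.ofReal a * ENNReal.ofReal (φ (w x)) +
          ENNReal.ofReal b * ENNReal.ofReal (φ (z x))) ∂μ := by
        refine lintegral_mono_ae ?_
        filter_upwards [Lp.coeFn_add (a • w) (b • z), Lp.coeFn_smul a w, Lp.coeFn_smul b z]
          with x h1 h2 h3
        rw [h1, Pi.add_apply, h2, h3]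
        exact hφ.ofReal_map_combo_le ha hb hab _ _
    _ = ENNReal.ofReal a * ∫⁻ x, ENNReal.ofReal (φ (w x)) ∂μ +
          ENNReal.ofReal b * ∫⁻ x, ENNReal.ofReal (φ (z x)) ∂μ := by
        rw [lintegral_add_left' ((hm w).const_mul _), lintegral_const_mul' _ _ ENNReal.ofReal_ne_top,
          lintegral_const_mul' _ _ ENNReal.ofReal_ne_top]
    _ ≤ ENNReal.ofReal a * c + ENNReal.ofReal b * c := by
        gcongr
        · exact hw
        · exact hz
    _ = c := by
        rw [← add_mul, ← ENNReal.ofReal_add ha hb, hab, ENNReal.ofReal_one, one_mul]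

theorem isClosed_setOf_lintegral_le {α : Type*} [MeasurableSpace α] {μ : Measure α} {φ : ℝ → ℝ}
    (hφ : IsClassN φ) (c : ENNReal) :
    IsClosed {w : Lp ℝ 1 μ | ∫⁻ x, ENNReal.ofReal (φ (w x)) ∂μ ≤ c} := by
  refine IsSeqClosed.isClosed fun w z hw hz => ?_
  obtain ⟨ns, -, hns⟩ := (tendstoInMeasure_of_tendsto_Lp hz).exists_seq_tendsto_ae
  have hm : ∀ q : Lp ℝ 1 μ, AEMeasurable (fun x => ENNReal.ofReal (φ (q x))) μ := fun q =>
    (hφ.continuous.measurable.comp_aemeasurable (Lp.aestronglyMeasurable q).aemeasurable).ennreal_ofReal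
  calc ∫⁻ x, ENNReal.ofReal (φ (z x)) ∂μ
      = ∫⁻ x, liminf (fun k => ENNReal.ofReal (φ (w (ns k) x))) atTop ∂μ := by
        refine lintegral_congr_ae (hns.mono fun x hx => ?_)
        exact ((ENNReal.continuous_ofReal.comp hφ.continuous).tendsto _ |>.comp hx).liminf_eq.symm
    _ ≤ liminf (fun k => ∫⁻ x, ENNReal.ofReal (φ (w (ns k) x)) ∂μ) atTop :=
        lintegral_liminf_le' fun k => hm _
    _ ≤ c := liminf_le_of_frequently_le'
        (Eventually.of_forall fun k => hw (ns k)).frequently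

/-- A closed convex set contains the limits of the combinations `∑ j, y j • T j u` when the
coefficients converge and `u` converges weakly: the combinations converge weakly, and a closed convex
set is weakly closed. -/
theorem Convex.sum_smul_mem_of_tendsto_weak {E F J ι : Type*} [Fintype J]
    [NormedAddCommGroup E] [NormedSpace ℝ E] [NormedAddCommGroup F] [NormedSpace ℝ F]
    {S : Set F} (hS : Convex ℝ S) (hSc : IsClosed S) (T : J → E →L[ℝ] F) {l : Filter ι} [l.NeBot]
    {u : ι → E} {u₀ : E} {y : ι → J → ℝ} {y₀ : J → ℝ}
    (hu : Tendsto (fun i => toWeakSpace ℝ E (u i)) l (𝓝 (toWeakSpace ℝ E u₀)))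
    (hy : Tendsto y l (𝓝 y₀)) (h : ∀ᶠ i in l, ∑ j, y i j • T j (u i) ∈ S) :
    ∑ j, y₀ j • T j u₀ ∈ S := by
  have hcl : IsClosed (toWeakSpace ℝ F '' S) := by
    rw [← hSc.closure_eq, hS.toWeakSpace_closure ℝ]
    exact isClosed_closure
  have e : ∀ (z : J → ℝ) (p : E), toWeakSpace ℝ F (∑ j, z j • T j p) =
      ∑ j, z j • WeakSpace.map (T j) (toWeakSpace ℝ E p) := fun z p => by
    rw [map_sum]
    exact Finset.sum_congr rfl fun j _ => map_smul _ _ _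
  have ht : Tendsto (fun i => toWeakSpace ℝ F (∑ j, y i j • T j (u i))) l
      (𝓝 (toWeakSpace ℝ F (∑ j, y₀ j • T j u₀))) := by
    rw [e]
    refine Tendsto.congr (fun i => (e _ _).symm) (tendsto_finsetSum _ fun j _ => ?_)
    exact (tendsto_pi_nhds.1 hy j).smul
      (((WeakSpace.map (T j)).continuous.tendsto (toWeakSpace ℝ E u₀)).comp hu)
  obtain ⟨z, hz, hze⟩ := hcl.mem_of_tendsto ht (h.mono fun i hi => mem_image_of_mem _ hi)
  rwa [← (toWeakSpace ℝ F).injective hze]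

/-- The modular `∫ φ(y ⬝ g)` of the directional component of a vector field. -/
noncomputable def dirModular {n : ℕ} (φ : ℝ → ℝ) (g : Eucl n → Eucl n) (y : Eucl n) : ENNReal :=
  ∫⁻ x, ENNReal.ofReal (φ (inner ℝ y (g x)))

/-- The directional component `y ⬝ ∇u` of the gradient, as a map `W^{1,1}(ℝⁿ) → L¹(ℝⁿ)`. -/
noncomputable def gradComponent {n : ℕ} (y : Eucl n) :
    SobolevW11 n →L[ℝ] Lp ℝ 1 (volume : Measure (Eucl n)) :=
  ((innerSL ℝ y).compLpL 1 volume).comp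
    ((WithLp.sndL 1 ℝ _ _).comp (SobolevW11 n).subtypeL)

theorem coeFn_gradComponent {n : ℕ} (y : Eucl n) (p : SobolevW11 n) :
    gradComponent y p =ᵐ[volume] fun x => inner ℝ y (p.1.snd x) :=
  (innerSL ℝ y).coeFn_compLpL (p := 1) p.1.snd

theorem lintegral_gradComponent {n : ℕ} (φ : ℝ → ℝ) (y : Eucl n) (p : SobolevW11 n) :
    ∫⁻ x, ENNReal.ofReal (φ (gradComponent y p x)) = dirModular φ p.1.snd y :=
  lintegral_congr_ae ((coeFn_gradComponent y p).mono fun x hx => by simp only [hx])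

theorem gradComponent_eq_sum {n : ℕ} (y : Eucl n) (p : SobolevW11 n) :
    gradComponent y p = ∑ i, y i • gradComponent (EuclideanSpace.single i 1) p := by
  refine Lp.ext ?_
  have h1 : ∀ᵐ x, ∀ i : Fin n, (gradComponent (EuclideanSpace.single i 1) p) x =
      inner ℝ (EuclideanSpace.single i 1) (p.1.snd x) :=
    ae_all_iff.2 fun i => coeFn_gradComponent _ p
  have h2 : ∀ᵐ x, ∀ i : Fin n, (y i • gradComponent (EuclideanSpace.single i 1) p :
      Lp ℝ 1 (volume : Measure (Eucl n))) x =
      y i * (gradComponent (EuclideanSpace.single i 1) p) x :=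
    ae_all_iff.2 fun i => (Lp.coeFn_smul _ _)
  filter_upwards [coeFn_gradComponent y p, h1, h2, Lp.coeFn_finsetSum Finset.univ
    fun i => y i • gradComponent (EuclideanSpace.single i 1) p] with x hx h1 h2 h3
  rw [hx, h3, Finset.sum_apply]
  simp only [h2, h1, EuclideanSpace.inner_single_left]
  simp [PiLp.inner_apply, mul_comm]

/-- Joint weak lower semicontinuity of the modular. -/
theorem dirModular_le_of_tendsto {n : ℕ} {φ : ℝ → ℝ} (hφ : IsClassN φ) {ι : Type*} {l : Filter ι}
    [l.NeBot] {u : ι → SobolevW11 n} {u₀ : SobolevW11 n} {y : ι → Eucl n} {y₀ : Eucl n}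
    {a : ι → ENNReal} {a₀ : ENNReal}
    (hu : Tendsto (fun i => toWeakSpace ℝ (SobolevW11 n) (u i)) l
      (𝓝 (toWeakSpace ℝ (SobolevW11 n) u₀)))
    (hy : Tendsto y l (𝓝 y₀)) (ha : Tendsto a l (𝓝 a₀))
    (h : ∀ᶠ i in l, dirModular φ (u i).1.snd (y i) ≤ a i) :
    dirModular φ u₀.1.snd y₀ ≤ a₀ := by
  refine le_of_forall_gt_imp_ge_of_dense fun b hb => ?_
  have hy' : Tendsto (fun i j => y i j) l (𝓝 fun j => y₀ j) :=
    ((PiLp.continuous_ofLp 2 _).tendsto y₀).comp hy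
  have hmem := (convex_setOf_lintegral_le (μ := volume) hφ b).sum_smul_mem_of_tendsto_weak
    (isClosed_setOf_lintegral_le hφ b)
    (fun j => gradComponent (EuclideanSpace.single j (1 : ℝ))) hu hy' (by
      filter_upwards [h, ha.eventually (gt_mem_nhds hb)] with i hi hib
      rw [← gradComponent_eq_sum, lintegral_gradComponent]
      exact hi.trans hib.le)
  rwa [← gradComponent_eq_sum, mem_ofPred_eq, lintegral_gradComponent] at hmem

/-! ### The modular of a Sobolev function -/

theorem dirModular_smul_le {n : ℕ} {φ : ℝ → ℝ} (hφ : IsClassN φ) (g : Eucl n → Eucl n) {s : ℝ}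
    (hs0 : 0 ≤ s) (hs1 : s ≤ 1) (y : Eucl n) :
    dirModular φ g (s • y) ≤ ENNReal.ofReal s * dirModular φ g y := by
  rw [dirModular, dirModular, ← lintegral_const_mul' _ _ ENNReal.ofReal_ne_top]
  refine lintegral_mono fun x => ?_
  rw [← ENNReal.ofReal_mul hs0, real_inner_smul_left]
  exact ENNReal.ofReal_le_ofReal (hφ.map_mul_le hs0 hs1 _)

theorem dirModular_smul_le_self {n : ℕ} {φ : ℝ → ℝ} (hφ : IsClassN φ) (g : Eucl n → Eucl n) {s : ℝ}
    (hs0 : 0 ≤ s) (hs1 : s ≤ 1) (y : Eucl n) : dirModular φ g (s • y) ≤ dirModular φ g y :=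
  (dirModular_smul_le hφ g hs0 hs1 y).trans
    (mul_le_of_le_one_left zero_le (ENNReal.ofReal_le_one.2 hs1))

theorem dirModular_zero {n : ℕ} {φ : ℝ → ℝ} (hφ : IsClassN φ) (g : Eucl n → Eucl n) :
    dirModular φ g 0 = 0 := by
  simp [dirModular, hφ.map_zero]

theorem convex_setOf_dirModular_le {n : ℕ} {φ : ℝ → ℝ} (hφ : IsClassN φ) (p : SobolevW11 n)
    (c : ENNReal) : Convex ℝ {y | dirModular φ p.1.snd y ≤ c} := by
  intro y hy z hz a b ha hb hab
  have e : gradComponent (a • y + b • z) p = a • gradComponent y p + b • gradComponent z p := by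
    rw [gradComponent_eq_sum (a • y + b • z), gradComponent_eq_sum y, gradComponent_eq_sum z]
    simp only [Finset.smul_sum, ← Finset.sum_add_distrib, smul_smul,
      ← add_smul]
    rfl
  have h := convex_setOf_lintegral_le (μ := volume) hφ c
    (x := gradComponent y p) (by simpa only [mem_ofPred_eq, lintegral_gradComponent] using hy)
    (y := gradComponent z p) (by simpa only [mem_ofPred_eq, lintegral_gradComponent] using hz)
    ha hb hab
  rw [← e] at h
  simpa only [mem_ofPred_eq, lintegral_gradComponent] using h

theorem isClosed_setOf_dirModular_le {n : ℕ} {φ : ℝ → ℝ} (hφ : IsClassN φ) (p : SobolevW11 n)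
    (c : ENNReal) : IsClosed {y | dirModular φ p.1.snd y ≤ c} :=
  IsSeqClosed.isClosed fun _ _ hy hlim =>
    dirModular_le_of_tendsto hφ (u := fun _ => p) tendsto_const_nhds hlim
      (tendsto_const_nhds (x := c)) (Eventually.of_forall hy)

section ZeroExtension

variable {n : ℕ} {φ : ℝ → ℝ} {G : Set (Eucl n)} {f : Eucl n → ℝ} {p : SobolevW11 n}

theorem ae_fst_eq_zero (hp : (p.1.fst : Eucl n → ℝ) =ᵐ[volume] G.indicator f) :
    ∀ᵐ x, x ∉ G → p.1.fst x = 0 :=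
  hp.mono fun x hx hxG => by rw [hx, indicator_of_notMem hxG]

theorem ae_snd_eq_zero (hG : IsOpen G)
    (hp : (p.1.fst : Eucl n → ℝ) =ᵐ[volume] G.indicator f) :
    ∀ᵐ x, x ∉ G → p.1.snd x = 0 :=
  HasWeakGradient.ae_eq_zero_of_notMem hG p.2 (L1.integrable_coeFn _) (L1.integrable_coeFn _)
    (ae_fst_eq_zero hp)

theorem WeaklyDifferentiable.hasWeakGradient {U : Set (Eucl n)} (h : WeaklyDifferentiable U f) :
    HasWeakGradient U f (weakGradient U f) := by
  rw [weakGradient, dif_pos h]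
  exact h.choose_spec

theorem setLIntegral_eq_dirModular (hφ : IsClassN φ) (hG : IsOpen G)
    (hf : WeaklyDifferentiable G f)
    (hp : (p.1.fst : Eucl n → ℝ) =ᵐ[volume] G.indicator f) (c : ℝ) (y : Eucl n) :
    ∫⁻ x in G, ENNReal.ofReal (φ (inner ℝ y (weakGradient G f x) / c)) =
      dirModular φ p.1.snd (c⁻¹ • y) := by
  rw [← lintegral_indicator hG.measurableSet]
  refine lintegral_congr_ae ?_
  filter_upwards [ae_snd_eq_zero hG hp,
    HasWeakGradient.ae_eq_of_indicator hG p.2 hp hf.hasWeakGradient] with x h1 h2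
  by_cases hx : x ∈ G
  · rw [indicator_of_mem hx, h2 hx, real_inner_smul_left, div_eq_inv_mul]
  · rw [indicator_of_notMem hx, h1 hx, inner_zero_right, hφ.map_zero, ENNReal.ofReal_zero]

/-- The set whose infimum is the norm is nonempty, so that the infimum is not a junk value. -/
theorem exists_dirModular_inv_smul_le (hφ : IsClassN φ) (hG : IsOpen G) (hG0 : volume G ≠ 0)
    (hf : MemOrliczSobolevZero φ G f)
    (hp : (p.1.fst : Eucl n → ℝ) =ᵐ[volume] G.indicator f) (y : Eucl n) :
    ∃ c : ℝ, 0 < c ∧ dirModular φ p.1.snd (c⁻¹ • y) ≤ volume G := by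
  obtain ⟨-, c₀, hc₀, hI⟩ := hf.1.2.2
  obtain ⟨δ, hδ, hδI⟩ := ENNReal.exists_nnreal_pos_mul_lt hI.ne hG0
  set ε : ℝ := min δ 1 with hε
  have hε0 : 0 < ε := lt_min hδ one_pos
  have hε1 : ε ≤ 1 := min_le_right _ _
  have hy : 0 < ‖y‖ + 1 := by positivity
  refine ⟨(‖y‖ + 1) * c₀ / ε, by positivity, ?_⟩
  rw [← setLIntegral_eq_dirModular hφ hG hf.1.2.1 hp]
  calc _ ≤ ∫⁻ x in G, ENNReal.ofReal ε *
        ENNReal.ofReal (orliczPhi φ (|‖weakGradient G f x‖| / c₀)) := by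
        refine lintegral_mono fun x => ?_
        rw [← ENNReal.ofReal_mul hε0.le]
        refine ENNReal.ofReal_le_ofReal (hφ.map_le_mul_orliczPhi hε0.le hε1 ?_)
        rw [abs_div, abs_of_pos (show 0 < (‖y‖ + 1) * c₀ / ε by positivity), abs_norm,
          div_le_iff₀ (by positivity)]
        calc |inner ℝ y (weakGradient G f x)| ≤ ‖y‖ * ‖weakGradient G f x‖ :=
              abs_real_inner_le_norm _ _
          _ ≤ (‖y‖ + 1) * ‖weakGradient G f x‖ := by gcongr; linarith
          _ = _ := by field_simp
    _ = ENNReal.ofReal ε * ∫⁻ x in G,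
          ENNReal.ofReal (orliczPhi φ (|‖weakGradient G f x‖| / c₀)) :=
        lintegral_const_mul' _ _ ENNReal.ofReal_ne_top
    _ ≤ δ * ∫⁻ x in G, ENNReal.ofReal (orliczPhi φ (|‖weakGradient G f x‖| / c₀)) := by
        gcongr
        rw [← ENNReal.ofReal_coe_nnreal]
        exact ENNReal.ofReal_le_ofReal (min_le_left _ _)
    _ ≤ volume G := hδI.le

/-- The unit ball of the affine norm is the sublevel set of the modular. -/
theorem affineBall_eq (hφ : IsClassN φ) (hG : IsOpen G) (hGb : Bornology.IsBounded G)
    (hG0 : volume G ≠ 0) (hf : MemOrliczSobolevZero φ G f)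
    (hp : (p.1.fst : Eucl n → ℝ) =ᵐ[volume] G.indicator f) :
    affineBall φ G f = {y | dirModular φ p.1.snd y ≤ volume G} := by
  have hGt : volume G ≠ ⊤ := hGb.measure_lt_top.ne
  ext y
  rw [affineBall, mem_ofPred_eq, mem_ofPred_eq, affineNorm]
  simp only [setLIntegral_eq_dirModular hφ hG hf.1.2.1 hp, ENNReal.inv_mul_le_iff hG0 hGt, mul_one]
  constructor
  · intro h
    -- every scale `1 + 1 / (k + 1) > 1` is admissible, and the modular is lower semicontinuous
    have hk : ∀ k : ℕ, dirModular φ p.1.snd ((1 + 1 / ((k : ℝ) + 1))⁻¹ • y) ≤ volume G := by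
      intro k
      have hpos : (0 : ℝ) < 1 / ((k : ℝ) + 1) := Nat.one_div_pos_of_nat
      obtain ⟨c, ⟨hc0, hc⟩, hck⟩ := exists_lt_of_csInf_lt
        (exists_dirModular_inv_smul_le hφ hG hG0 hf hp y)
        (h.trans_lt (lt_add_of_pos_right 1 hpos))
      have e : (1 + 1 / ((k : ℝ) + 1))⁻¹ • y = ((1 + 1 / ((k : ℝ) + 1))⁻¹ * c) • c⁻¹ • y := by
        rw [smul_smul, mul_assoc, mul_inv_cancel₀ hc0.ne', mul_one]
      rw [e]
      refine (dirModular_smul_le_self hφ _ (by positivity) ?_ _).trans hc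
      rw [inv_mul_le_iff₀ (by positivity), mul_one]
      exact hck.le
    have hlim : Tendsto (fun k : ℕ => (1 + 1 / ((k : ℝ) + 1))⁻¹ • y) atTop (𝓝 y) := by
      have h1 : Tendsto (fun k : ℕ => (1 + 1 / ((k : ℝ) + 1))⁻¹) atTop (𝓝 (1 + 0)⁻¹) :=
        (tendsto_const_nhds.add tendsto_one_div_add_atTop_nhds_zero_nat).inv₀ (by simp)
      simpa using h1.smul_const y
    exact (isClosed_setOf_dirModular_le hφ p (volume G)).mem_of_tendsto hlim
      (Eventually.of_forall hk)
  · intro h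
    exact csInf_le ⟨0, fun c hc => hc.1.le⟩ ⟨one_pos, by simpa using h⟩

/-- The modular is positive in every direction: `z ⬝ ∇u` has integral zero and is not a.e. zero, so
it takes both signs, and `φ` is positive on one side of the origin. -/
theorem dirModular_ne_zero (hφ : IsClassN φ) (hG : IsOpen G) (hGb : Bornology.IsBounded G)
    (hp : (p.1.fst : Eucl n → ℝ) =ᵐ[volume] G.indicator f)
    (hne : ¬ f =ᵐ[volume.restrict G] 0) {z : Eucl n} (hz : z ≠ 0) :
    dirModular φ p.1.snd z ≠ 0 := by
  intro h0
  set w : Eucl n → ℝ := fun x => inner ℝ z (p.1.snd x) with hw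
  have hwi : Integrable w := (L1.integrable_coeFn _).const_inner z
  have hd : IsWeakDirDeriv z p.1.fst w := HasWeakGradient.isWeakDirDeriv p.2 z
  obtain ⟨R, hR, hGR⟩ := hGb.subset_ball_lt 0 0
  have hu0 : ∀ᵐ x, x ∉ Metric.ball 0 R → p.1.fst x = 0 :=
    (ae_fst_eq_zero hp).mono fun x hx hxR => hx fun hxG => hxR (hGR hxG)
  have hw0 : ∀ᵐ x, x ∉ Metric.ball 0 R → w x = 0 :=
    (ae_snd_eq_zero hG hp).mono fun x hx hxR => by
      simp [hw, hx fun hxG => hxR (hGR hxG)]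
  have hint : ∫ x, w x = 0 := hd.integral_eq_zero hR hu0 hw0
  have hm : AEMeasurable (fun x => ENNReal.ofReal (φ (w x))) :=
    (hφ.continuous.measurable.comp_aemeasurable hwi.1.aemeasurable).ennreal_ofReal
  have hφw : ∀ᵐ x, φ (w x) ≤ 0 := ((lintegral_eq_zero_iff' hm).1 h0).mono fun x hx => by
    simpa using hx
  have hwz : w =ᵐ[volume] 0 := by
    rcases hφ.strict with hs | hs
    · have hnn : 0 ≤ᵐ[volume] w := hφw.mono fun x hx => by
        by_contra hc
        have hlt : w x < 0 := not_le.1 hc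
        have := hs (mem_Iic.2 hlt.le) (mem_Iic.2 le_rfl) hlt
        rw [hφ.map_zero] at this
        linarith
      exact (integral_eq_zero_iff_of_nonneg_ae hnn hwi).1 hint
    · have hnn : 0 ≤ᵐ[volume] -w := hφw.mono fun x hx => by
        by_contra hc
        have hlt : 0 < w x := by simpa using hc
        have := hs (mem_Ici.2 le_rfl) (mem_Ici.2 hlt.le) hlt
        rw [hφ.map_zero] at this
        linarith
      have := (integral_eq_zero_iff_of_nonneg_ae hnn hwi.neg).1 (by
        simp only [Pi.neg_apply, integral_neg, hint, neg_zero])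
      exact this.mono fun x hx => by simpa using hx
  have huz := hd.ae_eq_zero_of_bounded hz (L1.integrable_coeFn _) hwz hu0
  refine hne ((ae_restrict_iff' hG.measurableSet).2 ?_)
  filter_upwards [huz, hp] with x h1 h2 hxG
  rw [h1, indicator_of_mem hxG] at h2
  exact h2.symm

end ZeroExtension

/-! ### Hausdorff limits of convex bodies -/

section Hausdorff

variable {X : Type*} [MetricSpace X] {K : ℕ → TopologicalSpace.NonemptyCompacts X}
  {K₀ : TopologicalSpace.NonemptyCompacts X}

theorem tendsto_hausdorffDist (h : Tendsto K atTop (𝓝 K₀)) :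
    Tendsto (fun k => Metric.hausdorffDist (K k : Set X) (K₀ : Set X)) atTop (𝓝 0) :=
  tendsto_iff_dist_tendsto_zero.1 h

theorem hausdorffEDist_nonemptyCompacts_ne_top (L M : TopologicalSpace.NonemptyCompacts X) :
    Metric.hausdorffEDist (L : Set X) (M : Set X) ≠ ⊤ :=
  Metric.hausdorffEDist_ne_top_of_nonempty_of_bounded L.nonempty M.nonempty
    L.isCompact.isBounded M.isCompact.isBounded

/-- Every point of a Hausdorff limit is a limit of points of the sets. -/
theorem exists_tendsto_of_mem_hausdorff_limit (h : Tendsto K atTop (𝓝 K₀)) {y : X} (hy : y ∈ K₀) :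
    ∃ z : ℕ → X, (∀ k, z k ∈ K k) ∧ Tendsto z atTop (𝓝 y) := by
  choose z hz hzd using fun k => (K k).isCompact.exists_infDist_eq_dist (K k).nonempty y
  refine ⟨z, hz, tendsto_iff_dist_tendsto_zero.2 ?_⟩
  refine squeeze_zero (fun _ => dist_nonneg) (fun k => ?_) (tendsto_hausdorffDist h)
  rw [dist_comm, ← hzd k, Metric.hausdorffDist_comm]
  exact Metric.infDist_le_hausdorffDist_of_mem hy (hausdorffEDist_nonemptyCompacts_ne_top _ _)

/-- Limits of points of the sets belong to a Hausdorff limit. -/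
theorem mem_hausdorff_limit_of_tendsto (h : Tendsto K atTop (𝓝 K₀)) {y : X} {z : ℕ → X}
    (hz : ∀ k, z k ∈ K k) (hzy : Tendsto z atTop (𝓝 y)) : y ∈ K₀ := by
  have hd : Tendsto (fun k => Metric.infDist (z k) (K₀ : Set X)) atTop (𝓝 0) :=
    squeeze_zero (fun _ => Metric.infDist_nonneg)
      (fun k => Metric.infDist_le_hausdorffDist_of_mem (hz k)
        (hausdorffEDist_nonemptyCompacts_ne_top _ _)) (tendsto_hausdorffDist h)
  have hy := ((Metric.continuous_infDist_pt (K₀ : Set X)).tendsto y).comp hzy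
  exact (K₀.isCompact.isClosed.mem_iff_infDist_zero K₀.nonempty).2 (tendsto_nhds_unique hy hd)

end Hausdorff

/-- Blaschke's selection theorem: a bounded sequence of convex bodies has a subsequence converging to
a convex body, whose points are exactly the limits of points of the subsequence. -/
theorem ConvexBody.exists_subseq_tendsto {V : Type*} [NormedAddCommGroup V] [NormedSpace ℝ V]
    [ProperSpace V] (K : ℕ → ConvexBody V) (R : ℝ)
    (hK : ∀ k, (K k : Set V) ⊆ Metric.closedBall 0 R) :
    ∃ σ : ℕ → ℕ, StrictMono σ ∧ ∃ K₀ : ConvexBody V,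
      Tendsto (fun k => dist (K (σ k)) K₀) atTop (𝓝 0) ∧
      (∀ y ∈ K₀, ∃ z : ℕ → V, (∀ k, z k ∈ K (σ k)) ∧ Tendsto z atTop (𝓝 y)) ∧
      ∀ (y : V) (z : ℕ → V), (∀ k, z k ∈ K (σ k)) → Tendsto z atTop (𝓝 y) → y ∈ K₀ := by
  let L : ℕ → TopologicalSpace.NonemptyCompacts V := fun k =>
    ⟨⟨K k, (K k).isCompact⟩, (K k).nonempty⟩
  obtain ⟨L₀, -, σ, hσ, hL⟩ :=
    (TopologicalSpace.NonemptyCompacts.isCompact_subsets_of_isCompact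
      (isCompact_closedBall (0 : V) R)).tendsto_subseq (x := L) hK
  have hconv : Convex ℝ (L₀ : Set V) := by
    intro x hx y hy a b ha hb hab
    obtain ⟨x', hx', hxl⟩ := exists_tendsto_of_mem_hausdorff_limit hL hx
    obtain ⟨y', hy', hyl⟩ := exists_tendsto_of_mem_hausdorff_limit hL hy
    exact mem_hausdorff_limit_of_tendsto hL
      (fun k => (K (σ k)).convex (hx' k) (hy' k) ha hb hab)
      ((hxl.const_smul a).add (hyl.const_smul b))
  exact ⟨σ, hσ, ⟨L₀, hconv, L₀.isCompact, L₀.nonempty⟩, tendsto_hausdorffDist hL,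
    fun y hy => exists_tendsto_of_mem_hausdorff_limit hL hy,
    fun y z hz hzy => mem_hausdorff_limit_of_tendsto hL hz hzy⟩

/-! ### Boundedness and convergence of the affine balls -/

/-- Along a weakly convergent sequence the sublevel sets of the modulars are eventually uniformly
bounded: otherwise normalising points that go to infinity gives, in the limit, a direction in which
the modular of the weak limit vanishes. -/
theorem exists_eventually_norm_le_of_dirModular_le {n : ℕ} {φ : ℝ → ℝ} (hφ : IsClassN φ)
    {u : ℕ → SobolevW11 n} {u₀ : SobolevW11 n}
    (hu : Tendsto (fun i => toWeakSpace ℝ (SobolevW11 n) (u i)) atTop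
      (𝓝 (toWeakSpace ℝ (SobolevW11 n) u₀)))
    (hpos : ∀ z : Eucl n, z ≠ 0 → dirModular φ u₀.1.snd z ≠ 0)
    {a : ℕ → ENNReal} {a₀ : ENNReal} (ha : Tendsto a atTop (𝓝 a₀)) (ha₀ : a₀ ≠ ⊤) :
    ∃ R : ℝ, ∀ᶠ i in atTop, ∀ y : Eucl n, dirModular φ (u i).1.snd y ≤ a i → ‖y‖ ≤ R := by
  by_contra! hcon
  have hseq : ∀ k : ℕ, ∃ i ≥ k, ∃ y : Eucl n,
      dirModular φ (u i).1.snd y ≤ a i ∧ (k : ℝ) + 1 < ‖y‖ := fun k =>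
    (hcon ((k : ℝ) + 1)).forall_exists_of_atTop k
  choose i hik y hy hky using hseq
  have hi : Tendsto i atTop atTop := tendsto_atTop_mono hik tendsto_id
  have hy1 : ∀ k, 1 < ‖y k‖ := fun k => lt_of_le_of_lt (by simp) (hky k)
  have hy0 : ∀ k, 0 < ‖y k‖ := fun k => one_pos.trans (hy1 k)
  have hinv : Tendsto (fun k => ‖y k‖⁻¹) atTop (𝓝 0) :=
    (tendsto_atTop_mono (fun k => (lt_add_one _).le.trans (hky k).le)
      tendsto_natCast_atTop_atTop).inv_tendsto_atTop
  obtain ⟨z, hz, τ, hτ, hlim⟩ := (isCompact_sphere (0 : Eucl n) 1).tendsto_subseq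
    (x := fun k => ‖y k‖⁻¹ • y k) fun k => by
      rw [mem_sphere_zero_iff_norm, norm_smul, norm_inv, norm_norm,
        inv_mul_cancel₀ (hy0 k).ne']
  have hz0 : z ≠ 0 := by
    rintro rfl
    simp at hz
  have hat : Tendsto (fun k => ENNReal.ofReal ‖y k‖⁻¹ * a (i k)) atTop (𝓝 0) := by
    have := ENNReal.Tendsto.mul (ENNReal.tendsto_ofReal hinv) (Or.inr ha₀) (ha.comp hi)
      (Or.inr ENNReal.ofReal_ne_top)
    simpa using this
  have hle : dirModular φ u₀.1.snd z ≤ 0 := by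
    refine dirModular_le_of_tendsto hφ (u := fun k => u (i (τ k)))
      (hu.comp (hi.comp hτ.tendsto_atTop)) hlim (hat.comp hτ.tendsto_atTop)
      (Eventually.of_forall fun k => ?_)
    exact (dirModular_smul_le hφ _ (inv_nonneg.2 (norm_nonneg _))
      (inv_le_one_of_one_le₀ (hy1 _).le) _).trans (mul_le_mul' le_rfl (hy _))
  exact hpos z hz0 (le_antisymm hle zero_le)

theorem lemma72 {n : ℕ} (φ : ℝ → ℝ) (hφ : IsClassN φ) (hΦ : IsSuperlinear φ)
    (G₀ : Set (Eucl n)) (G : ℕ → Set (Eucl n))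
    (hG₀ : IsOpen G₀) (hG₀b : Bornology.IsBounded G₀)
    (hG : ∀ i, IsOpen (G i)) (hGb : ∀ i, Bornology.IsBounded (G i))
    (f₀ : Eucl n → ℝ) (f : ℕ → Eucl n → ℝ)
    (hf₀ : MemOrliczSobolevZero φ G₀ f₀) (hf : ∀ i, MemOrliczSobolevZero φ (G i) (f i))
    (hf₀_ne : ¬ f₀ =ᵐ[volume.restrict G₀] 0)
    (hvol : Tendsto (fun i => volume (G i)) atTop (𝓝 (volume G₀)))
    (hweak : WeaklyConvergesW11 (fun i => (G i).indicator (f i)) (G₀.indicator f₀)) :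
    ∃ σ : ℕ → ℕ, StrictMono σ ∧ ∃ (K : ℕ → ConvexBody (Eucl n)) (K₀ : ConvexBody (Eucl n)),
      (∀ k, (K k : Set (Eucl n)) = affineBall φ (G (σ k)) (f (σ k))) ∧
      (0 : Eucl n) ∈ K₀ ∧
      Tendsto (fun k => dist (K k) K₀) atTop (𝓝 0) ∧
      (K₀ : Set (Eucl n)) ⊆ affineBall φ G₀ f₀ := by
  obtain ⟨u, u₀, hu, hu₀, hlim⟩ := hweak
  have hG₀0 : volume G₀ ≠ 0 := fun h => hf₀_ne (by
    rw [Measure.restrict_eq_zero.2 h]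
    exact ae_zero.symm ▸ eventually_bot)
  have hG₀t : volume G₀ ≠ ⊤ := hG₀b.measure_lt_top.ne
  obtain ⟨R, hR⟩ := exists_eventually_norm_le_of_dirModular_le hφ hlim
    (fun z hz => dirModular_ne_zero hφ hG₀ hG₀b hu₀ hf₀_ne hz) hvol hG₀t
  obtain ⟨N, hN⟩ := eventually_atTop.1 (hR.and (hvol.eventually_ne hG₀0))
  -- discard the finitely many indices at which the ball need not be bounded
  have hball : ∀ k, affineBall φ (G (k + N)) (f (k + N)) =
      {y | dirModular φ (u (k + N)).1.snd y ≤ volume (G (k + N))} := fun k =>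
    affineBall_eq hφ (hG _) (hGb _) (hN _ (Nat.le_add_left N k)).2 (hf _) (hu _)
  have hsub : ∀ k, {y | dirModular φ (u (k + N)).1.snd y ≤ volume (G (k + N))} ⊆
      Metric.closedBall 0 R := fun k y hy =>
    mem_closedBall_zero_iff.2 ((hN _ (Nat.le_add_left N k)).1 y hy)
  have hzero : ∀ k, (0 : Eucl n) ∈ {y | dirModular φ (u (k + N)).1.snd y ≤ volume (G (k + N))} :=
    fun k => (dirModular_zero hφ _).trans_le zero_le
  let K : ℕ → ConvexBody (Eucl n) := fun k =>
    ⟨{y | dirModular φ (u (k + N)).1.snd y ≤ volume (G (k + N))},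
      convex_setOf_dirModular_le hφ _ _,
      (isCompact_closedBall (0 : Eucl n) R).of_isClosed_subset
        (isClosed_setOf_dirModular_le hφ _ _) (hsub k), ⟨0, hzero k⟩⟩
  obtain ⟨σ, hσ, K₀, hK, hK1, hK2⟩ := ConvexBody.exists_subseq_tendsto K R hsub
  have hσN : StrictMono fun k => σ k + N := hσ.add_const N
  refine ⟨fun k => σ k + N, hσN, fun k => K (σ k), K₀, fun k => (hball _).symm,
    hK2 0 (fun _ => 0) (fun k => hzero _) tendsto_const_nhds, hK, fun y hy => ?_⟩
  obtain ⟨z, hz, hzy⟩ := hK1 y hy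
  rw [affineBall_eq hφ hG₀ hG₀b hG₀0 hf₀ hu₀]
  exact dirModular_le_of_tendsto hφ (u := fun k => u (σ k + N))
    (hlim.comp hσN.tendsto_atTop) hzy (hvol.comp hσN.tendsto_atTop) (Eventually.of_forall hz)
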